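/- Theorem B. Let $P\in\mathbb C[y]$ be a polynomial of degree at least $2$, let $\delta\in\mathbb C\setminus\{0\}$, and let $\theta\in(0,2\pi)\setminus\{\tfrac{\pi}{2},\pi,\tfrac{3\pi}{2}\}$. Let $h_1:\mathbb C^2\to\mathbb C^2$ be the generalized Hénon map $h_1(x,y)=(y,\,P(y)-\delta x)$, let $R_\theta:\mathbb C^2\to\mathbb C^2$ be the linear map with matrix $\begin{pmatrix}\cos\theta&-\sin\theta\\ \sin\theta&\cos\theta\end{pmatrix}$, let $h_2=R_\theta^{-1}\circ h_1\circ R_\theta$, and let $G=\langle h_1,h_2\rangle$ be the group of homeomorphisms of $\mathbb C^2$ generated by $h_1$ and $h_2$. Let $\nu=a_1\delta_{h_1}+a_2\delta_{h_2}+a_3\delta_{h_1^{-1}}+a_4\delta_{h_2^{-1}}$ be a probability measure on $G$, where $a_1,a_2,a_3,a_4>0$, $a_1+a_2+a_3+a_4=1$ and $\delta_g$ denotes the unit point mass at $g$. Let $\mu$ be a Borel probability measure on $\mathbb C^2$ that is $\nu$-stationary, that is, $\mu=\int_G g_*\mu\,d\nu(g)$. Then the support of $\mu$ is compact. -/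

import Mathlib

open MeasureTheory

/-- The homeomorphism group of a space acts on it by evaluation. -/
instance Homeomorph.evalMulAction {X : Type*} [TopologicalSpace X] : MulAction (X ≃ₜ X) X where
  smul g x := g x
  one_smul _ := rfl
  mul_smul _ _ _ := rfl

/-- A measure `μ` on `X` is `ν`-stationary, for a measure `ν` on a group `Γ` that acts on `X`, if
`μ = ∫ g_* μ dν(g)`: the `ν`-average of `μ (g⁻¹ A)` is `μ A` for every measurable set `A`. -/
def IsStationaryMeasure {Γ X : Type*} [Group Γ] [MeasurableSpace Γ] [MulAction Γ X] [MeasurableSpace X]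
    (ν : Measure Γ) (μ : Measure X) : Prop :=
  ∀ A : Set X, MeasurableSet A → ∫⁻ g, (μ.map (fun x => g • x)) A ∂ν = μ A

/-- The generalized Hénon map `(x, y) ↦ (y, P(y) - δ x)` of `ℂ²`, with `δ ≠ 0`; its inverse is
`(x, y) ↦ ((P(x) - y) / δ, x)`. -/
noncomputable def henonMap (P : Polynomial ℂ) (δ : ℂ) (hδ : δ ≠ 0) : (ℂ × ℂ) ≃ₜ (ℂ × ℂ) where
  toFun z := (z.2, P.eval z.2 - δ * z.1)
  invFun z := ((P.eval z.1 - z.2) / δ, z.1)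
  left_inv z := by
    ext
    · simp [hδ]
    · simp
  right_inv z := by
    ext
    · simp
    · simp only
      field_simp
      ring
  continuous_toFun := by
    have := P.continuous
    fun_prop
  continuous_invFun := by
    have := P.continuous
    fun_prop

/-- The linear map of `ℂ²` with the matrix `!![cos θ, -sin θ; sin θ, cos θ]`. -/
noncomputable def rotationMap (θ : ℝ) : (ℂ × ℂ) ≃ₜ (ℂ × ℂ) where
  toFun z := ((Real.cos θ : ℂ) * z.1 - (Real.sin θ : ℂ) * z.2,
    (Real.sin θ : ℂ) * z.1 + (Real.cos θ : ℂ) * z.2)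
  invFun z := ((Real.cos θ : ℂ) * z.1 + (Real.sin θ : ℂ) * z.2,
    -(Real.sin θ : ℂ) * z.1 + (Real.cos θ : ℂ) * z.2)
  left_inv z := by
    have h : (Real.cos θ : ℂ) ^ 2 + (Real.sin θ : ℂ) ^ 2 = 1 := by
      exact_mod_cast Real.cos_sq_add_sin_sq θ
    ext
    · linear_combination z.1 * h
    · linear_combination z.2 * h
  right_inv z := by
    have h : (Real.cos θ : ℂ) ^ 2 + (Real.sin θ : ℂ) ^ 2 = 1 := by
      exact_mod_cast Real.cos_sq_add_sin_sq θ
    ext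
    · linear_combination z.1 * h
    · linear_combination z.2 * h
  continuous_toFun := by fun_prop
  continuous_invFun := by fun_prop

/-- The conjugate `R_θ⁻¹ ∘ h ∘ R_θ` of the Hénon map `h` (multiplication of homeomorphisms is
composition). -/
noncomputable def rotatedHenonMap (P : Polynomial ℂ) (δ : ℂ) (hδ : δ ≠ 0) (θ : ℝ) :
    (ℂ × ℂ) ≃ₜ (ℂ × ℂ) :=
  (rotationMap θ)⁻¹ * henonMap P δ hδ * rotationMap θ

/-- The group `G = ⟨h₁, h₂⟩`, where `h₁` is the Hénon map and `h₂` its conjugate by `R_θ`. -/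
noncomputable def henonGroup (P : Polynomial ℂ) (δ : ℂ) (hδ : δ ≠ 0) (θ : ℝ) :
    Subgroup ((ℂ × ℂ) ≃ₜ (ℂ × ℂ)) :=
  Subgroup.closure {henonMap P δ hδ, rotatedHenonMap P δ hδ θ}

namespace henonGroup

/-- `G` is a discrete group: all of its subsets are measurable. -/
instance instMeasurableSpace (P : Polynomial ℂ) (δ : ℂ) (hδ : δ ≠ 0) (θ : ℝ) :
    MeasurableSpace (henonGroup P δ hδ θ) := ⊤

/-- The generator `h₁` of `G`. -/
noncomputable def gen₁ (P : Polynomial ℂ) (δ : ℂ) (hδ : δ ≠ 0) (θ : ℝ) : henonGroup P δ hδ θ :=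
  ⟨henonMap P δ hδ, Subgroup.subset_closure (Set.mem_insert _ _)⟩

/-- The generator `h₂` of `G`. -/
noncomputable def gen₂ (P : Polynomial ℂ) (δ : ℂ) (hδ : δ ≠ 0) (θ : ℝ) : henonGroup P δ hδ θ :=
  ⟨rotatedHenonMap P δ hδ θ, Subgroup.subset_closure (Set.mem_insert_of_mem _ rfl)⟩

/-- The measure `ν = a₁ δ_{h₁} + a₂ δ_{h₂} + a₃ δ_{h₁⁻¹} + a₄ δ_{h₂⁻¹}` on `G`. -/
noncomputable def stepMeasure (P : Polynomial ℂ) (δ : ℂ) (hδ : δ ≠ 0) (θ : ℝ) (a₁ a₂ a₃ a₄ : ℝ) :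
    Measure (henonGroup P δ hδ θ) :=
  ENNReal.ofReal a₁ • Measure.dirac (gen₁ P δ hδ θ) +
  ENNReal.ofReal a₂ • Measure.dirac (gen₂ P δ hδ θ) +
  ENNReal.ofReal a₃ • Measure.dirac (gen₁ P δ hδ θ)⁻¹ +
  ENNReal.ofReal a₄ • Measure.dirac (gen₂ P δ hδ θ)⁻¹

end henonGroup

/-! The four letters h₁, h₂ and their inverses play ping-pong near infinity. Each letter has a bad
cone around a complex line, the four cones meet only at 0, and a far point outside the bad cone of a
letter is sent farther out, into the bad cone of the inverse letter (`exists_henonLetter_pingPong`).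
Hence, after a good first letter, every reduced word drives a far point outwards, and the walk can
come back only by cancelling letters, as on a free group.

On that free group the walk is transient, even when the weights are not symmetric:
`exists_contracted_letter_weights` gives a multiplicative function of reduced words that averaging
contracts by ρ < 1. It bounds the chance of ever cancelling back to the starting point, so every far
point escapes to infinity with probability at least p, uniformly (`exists_escape_probability`).

Stationarity forbids this. Averaging the indicator of a ball preserves its μ-integral, which in the
limit is at most 1 - p μ(far). Letting the ball exhaust the space gives μ(far) = 0
(`measure_far_eq_zero`). -/

/-! ### Transience of the walk on the free group -/

/-- Weights on the letters of a free group whose product over a reduced word is contracted by the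
averaging operator of the random walk with step probabilities `a`. -/
lemma exists_contracted_letter_weights {L : Type*} [Fintype L] [DecidableEq L] {a : L → ℝ}
    (ha : ∀ h, 0 < a h) (hsum : ∑ h, a h = 1) {inv : L → L} (hinv : Function.Involutive inv)
    (hne : ∀ g, inv g ≠ g) (hthird : ∀ g, ∃ k, k ≠ g ∧ k ≠ inv g) :
    ∃ (c : L → ℝ) (ρ : ℝ), 0 < ρ ∧ ρ < 1 ∧ (∀ h, 0 < c h) ∧ (∀ h, c h * c (inv h) < 1) ∧
      ∀ g, ∑ h ∈ Finset.univ.erase (inv g), a h * c h + a (inv g) / c g ≤ ρ := by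
  -- The weights will be c h = α m h / a h. For α = 1 the sum to be bounded is ∑ m ≤ 1 by AM-GM; α
  -- slightly below 1 makes it strictly smaller.
  set m : L → ℝ := fun h => √(a h * a (inv h)) with hm
  have hmpos : ∀ h, 0 < m h := fun h => Real.sqrt_pos.2 (mul_pos (ha _) (ha _))
  have hmsq : ∀ h, m h * m h = a h * a (inv h) := fun h =>
    Real.mul_self_sqrt (mul_pos (ha _) (ha _)).le
  have hminv : ∀ h, m (inv h) = m h := fun h => by simp only [hm, hinv h, mul_comm]
  have hmle : ∀ h, m h ≤ (a h + a (inv h)) / 2 := fun h => by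
    have := hmsq h
    have := hmpos h
    have := ha h
    have := ha (inv h)
    nlinarith [sq_nonneg (a h - a (inv h))]
  have hmsum : ∑ h, m h ≤ 1 := by
    calc ∑ h, m h ≤ ∑ h, (a h + a (inv h)) / 2 := Finset.sum_le_sum fun h _ => hmle h
      _ = 1 := by
        have : ∑ h, a (inv h) = ∑ h, a h := Equiv.sum_comp hinv.toPerm a
        rw [← Finset.sum_div, Finset.sum_add_distrib, this, hsum]
        norm_num
  have hmhalf : ∀ g, m g < 1 / 2 := fun g => by
    obtain ⟨k, hk1, hk2⟩ := hthird g
    have h3 : ∑ h ∈ {g, inv g, k}, a h ≤ ∑ h, a h :=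
      Finset.sum_le_sum_of_subset_of_nonneg (Finset.subset_univ _) fun h _ _ => (ha h).le
    rw [Finset.sum_insert (by simp [(hne g).symm, hk1.symm]),
      Finset.sum_insert (by simp [hk2.symm]), Finset.sum_singleton, hsum] at h3
    linarith [hmle g, ha k]
  -- α(1 - m) + m/α < 1 amounts to (α - 1)(α(1 - m) - m) < 0, so α has to lie between m/(1 - m) and
  -- 1; that interval is nonempty because m < 1/2.
  have hevα : ∀ᶠ α : ℝ in nhdsWithin 1 (Set.Iio 1), ∀ g, m g < α * (1 - m g) := by
    refine Filter.eventually_all.2 fun g => ?_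
    have : Filter.Tendsto (fun α : ℝ => α * (1 - m g)) (nhdsWithin 1 (Set.Iio 1))
        (nhds (1 * (1 - m g))) := Filter.Tendsto.mul_const _ (Filter.tendsto_id.mono_left inf_le_left)
    exact this.eventually_const_lt (by linarith [hmhalf g])
  obtain ⟨α, hα, hα0, hα1⟩ :=
    (hevα.and (Ioo_mem_nhdsLT (show (0 : ℝ) < 1 by norm_num))).exists
  have hlt : ∀ g, α * (1 - m g) + m g / α < 1 := fun g => by
    have h1 := hα g
    have : m g / α * α = m g := div_mul_cancel₀ _ hα0.ne'
    by_contra! hcon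
    nlinarith [mul_le_mul_of_nonneg_right hcon hα0.le]
  have hevρ : ∀ᶠ ρ : ℝ in nhdsWithin 1 (Set.Iio 1), ∀ g, α * (1 - m g) + m g / α < ρ :=
    Filter.eventually_all.2 fun g => (eventually_gt_nhds (hlt g)).filter_mono inf_le_left
  obtain ⟨ρ, hρ, hρ0, hρ1⟩ :=
    (hevρ.and (Ioo_mem_nhdsLT (show (0 : ℝ) < 1 by norm_num))).exists
  have hac : ∀ h, a h * (α * m h / a h) = α * m h := fun h => mul_div_cancel₀ _ (ha h).ne'
  refine ⟨fun h => α * m h / a h, ρ, hρ0, hρ1,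
    fun h => div_pos (mul_pos hα0 (hmpos h)) (ha h), fun h => ?_, fun g => ?_⟩
  · have h1 := (ha h).ne'
    have h2 := (ha (inv h)).ne'
    have : α * m h / a h * (α * m (inv h) / a (inv h)) = α ^ 2 := by
      rw [hminv]
      field_simp
      linear_combination hmsq h
    change α * m h / a h * (α * m (inv h) / a (inv h)) < 1
    rw [this]
    nlinarith
  · refine le_trans ?_ (hρ g).le
    have h1 : ∑ h ∈ Finset.univ.erase (inv g), a h * (α * m h / a h) ≤ α * (1 - m g) := by
      simp_rw [hac, ← Finset.mul_sum]
      refine mul_le_mul_of_nonneg_left ?_ hα0.le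
      have := Finset.add_sum_erase Finset.univ m (Finset.mem_univ (inv g))
      linarith [hminv g]
    have h2 : a (inv g) / (α * m g / a g) = m g / α := by
      have h1 := (ha g).ne'
      have h2 := (hmpos g).ne'
      have h3 := hα0.ne'
      field_simp
      linear_combination -hmsq g
    change ∑ h ∈ Finset.univ.erase (inv g), a h * (α * m h / a h) + a (inv g) / (α * m g / a g) ≤ _
    rw [h2]
    linarith

/-! ### Averaging along reduced paths and escape to infinity -/

/-- The iterates of the averaging operator `f ↦ ∑ h, a h • f ∘ T h`. -/
def averagingIterate {L X : Type*} [Fintype L] (a : L → ℝ) (T : L → X → X) (f : X → ℝ) :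
    ℕ → X → ℝ
  | 0 => f
  | n + 1 => fun x => ∑ h, a h * averagingIterate a T f n (T h x)

/-- `ReducedPath inv T g z w x` says that `x` is the image of `z` under the reduced word `w`, whose
letters act through `T`, the last letter first, and whose last letter is `g`. -/
inductive ReducedPath {L X : Type*} (inv : L → L) (T : L → X → X) (g : L) (z : X) :
    List L → X → Prop
  | single : ReducedPath inv T g z [g] (T g z)
  | cons {h k : L} {w : List L} {x : X} (hp : ReducedPath inv T g z (k :: w) x) (hk : h ≠ inv k) :
      ReducedPath inv T g z (h :: k :: w) (T h x)

section

variable {L X : Type*}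

lemma averagingIterate_nonneg [Fintype L] {a : L → ℝ} (ha : ∀ h, 0 < a h) (T : L → X → X)
    {f : X → ℝ} (hf : ∀ x, 0 ≤ f x) (n : ℕ) (x : X) : 0 ≤ averagingIterate a T f n x := by
  induction n generalizing x with
  | zero => exact hf x
  | succ n ih => exact Finset.sum_nonneg fun h _ => mul_nonneg (ha h).le (ih _)

lemma averagingIterate_le_one [Fintype L] {a : L → ℝ} (ha : ∀ h, 0 < a h) (hsum : ∑ h, a h = 1)
    (T : L → X → X) {f : X → ℝ} (hf : ∀ x, f x ≤ 1) (n : ℕ) (x : X) :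
    averagingIterate a T f n x ≤ 1 := by
  induction n generalizing x with
  | zero => exact hf x
  | succ n ih =>
    rw [← hsum]
    exact Finset.sum_le_sum fun h _ => mul_le_of_le_one_right (ha h).le (ih _)

lemma measurable_averagingIterate [Fintype L] [MeasurableSpace X] (a : L → ℝ) {T : L → X → X}
    (hT : ∀ h, Measurable (T h)) {f : X → ℝ} (hf : Measurable f) (n : ℕ) :
    Measurable (averagingIterate a T f n) := by
  induction n with
  | zero => exact hf
  | succ n ih => exact Finset.measurable_sum _ fun h _ => (ih.comp (hT h)).const_mul _

/-- The data of a ping-pong at infinity: away from the pairwise disjoint sets `B h`, far out with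
respect to the size `N`, the map `T h` increases the size and maps into `B (inv h)`. -/
structure PingPongAtInfinity (inv : L → L) (T : L → X → X) (N : X → ℝ) (B : L → Set X)
    (R : ℝ) : Prop where
  cancel : ∀ h x, T (inv h) (T h x) = x
  disjoint : ∀ x, R < N x → ∀ h k, x ∈ B h → x ∈ B k → h = k
  mapsTo : ∀ x, R < N x → ∀ h, x ∉ B h → T h x ∈ B (inv h)
  growth : ∀ x, R < N x → ∀ h, x ∉ B h → N x + 1 ≤ N (T h x)

namespace PingPongAtInfinity

variable {inv : L → L} {T : L → X → X} {N : X → ℝ} {B : L → Set X} {R : ℝ}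

/-- Reducedness is what keeps the next letter good: the point lies in the bad set of the inverse of
the last letter applied, hence in no other bad set. -/
lemma reducedPath_far (H : PingPongAtInfinity inv T N B R) {g : L} {z : X} (hz : R < N z)
    (hg : z ∉ B g) {w : List L} {x : X} (hp : ReducedPath inv T g z w x) :
    (∀ k ∈ w.head?, x ∈ B (inv k)) ∧ R + w.length < N x := by
  induction hp with
  | single =>
    refine ⟨by simpa using H.mapsTo z hz g hg, ?_⟩
    have := H.growth z hz g hg
    simp only [List.length_singleton, Nat.cast_one]
    linarith
  | @cons h k w x hp hk ih =>
    obtain ⟨h1, h2⟩ := ih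
    have hx : R < N x := lt_of_le_of_lt (le_add_of_nonneg_right (Nat.cast_nonneg _)) h2
    have hxB : x ∉ B h := fun h3 => hk (H.disjoint x hx _ _ h3 (h1 k (by simp)))
    refine ⟨by simpa using H.mapsTo x hx h hxB, ?_⟩
    have := H.growth x hx h hxB
    rw [List.length_cons]
    push_cast
    linarith

variable [Fintype L] [DecidableEq L]

/-- The weight of the word is a supersolution. Appending a letter multiplies it by c, cancelling one
divides it by c, and the average contracts by ρ. The summand 1 pays for returns to `z`, where only f
≤ 1 is known. -/
lemma averagingIterate_le_of_reducedPath (H : PingPongAtInfinity inv T N B R) {a : L → ℝ}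
    (ha : ∀ h, 0 < a h) (hsum : ∑ h, a h = 1) {c : L → ℝ} {ρ : ℝ} (hρ0 : 0 < ρ) (hρ1 : ρ < 1)
    (hc : ∀ h, 0 < c h)
    (hcρ : ∀ g, ∑ h ∈ Finset.univ.erase (inv g), a h * c h + a (inv g) / c g ≤ ρ)
    {f : X → ℝ} (hf : ∀ x, f x ≤ 1) {C : ℝ} (hC : 0 ≤ C) {g : L} {z : X}
    (h0 : ∀ w x, ReducedPath inv T g z w x → f x ≤ (w.map c).prod * C)
    (n : ℕ) {w : List L} {x : X} (hp : ReducedPath inv T g z w x) :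
    averagingIterate a T f n x ≤ (w.map c).prod * (1 + C * ρ ^ n) := by
  have hprod : ∀ w : List L, 0 < (w.map c).prod := fun w =>
    List.prod_pos (by simpa using fun h _ => hc h)
  induction n generalizing w x with
  | zero =>
    refine (h0 w x hp).trans ?_
    rw [pow_zero, mul_one]
    exact mul_le_mul_of_nonneg_left (by linarith) (hprod w).le
  | succ n ih =>
    set D : ℝ := 1 + C * ρ ^ n with hD
    have hD1 : 1 ≤ D := le_add_of_nonneg_right (mul_nonneg hC (pow_pos hρ0 n).le)
    -- Only the cancelling step depends on the length of the word, so its bound is left as a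
    -- hypothesis.
    have key : ∀ (k : L) (u : List L), w = k :: u →
        averagingIterate a T f n (T (inv k) x) ≤ (u.map c).prod * D →
        averagingIterate a T f (n + 1) x ≤ (w.map c).prod * (1 + C * ρ ^ (n + 1)) := by
      rintro k u rfl hback
      have hfor : ∀ h ∈ Finset.univ.erase (inv k), a h * averagingIterate a T f n (T h x) ≤
          (a h * c h) * (((k :: u).map c).prod * D) := fun h hh => by
        have := ih (hp.cons (Finset.ne_of_mem_erase hh))
        rw [List.map_cons (a := h), List.prod_cons] at this
        rw [mul_assoc]
        refine mul_le_mul_of_nonneg_left (this.trans_eq (by ring)) (ha h).le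
      have hb : a (inv k) * averagingIterate a T f n (T (inv k) x) ≤
          a (inv k) / c k * (((k :: u).map c).prod * D) := by
        have : a (inv k) / c k * (((k :: u).map c).prod * D)
            = a (inv k) * ((u.map c).prod * D) := by
          rw [List.map_cons, List.prod_cons]
          have := (hc k).ne'
          field_simp
        rw [this]
        exact mul_le_mul_of_nonneg_left hback (ha _).le
      calc averagingIterate a T f (n + 1) x
          = a (inv k) * averagingIterate a T f n (T (inv k) x) +
              ∑ h ∈ Finset.univ.erase (inv k), a h * averagingIterate a T f n (T h x) :=
            (Finset.add_sum_erase _ _ (Finset.mem_univ _)).symm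
        _ ≤ a (inv k) / c k * (((k :: u).map c).prod * D) +
              ∑ h ∈ Finset.univ.erase (inv k), (a h * c h) * (((k :: u).map c).prod * D) :=
            add_le_add hb (Finset.sum_le_sum hfor)
        _ = (∑ h ∈ Finset.univ.erase (inv k), a h * c h + a (inv k) / c k) *
              (((k :: u).map c).prod * D) := by rw [← Finset.sum_mul]; ring
        _ ≤ ρ * (((k :: u).map c).prod * D) :=
            mul_le_mul_of_nonneg_right (hcρ k) (mul_nonneg (hprod _).le (by linarith))
        _ = ((k :: u).map c).prod * (ρ + C * ρ ^ (n + 1)) := by rw [hD]; ring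
        _ ≤ _ := mul_le_mul_of_nonneg_left (by linarith) (hprod _).le
    cases hp with
    | single =>
      refine key g [] rfl ?_
      rw [H.cancel]
      simpa using (averagingIterate_le_one ha hsum T hf n z).trans hD1
    | @cons h k u y hp hk =>
      refine key h (k :: u) rfl ?_
      rw [H.cancel]
      exact ih hp

/-- For a random walk that plays ping-pong at infinity, far points have a probability of escape
that is bounded from below. -/
lemma exists_escape_probability (H : PingPongAtInfinity inv T N B R) {a : L → ℝ}
    (ha : ∀ h, 0 < a h) (hsum : ∑ h, a h = 1) (hinv : Function.Involutive inv)
    (hne : ∀ g, inv g ≠ g) (hthird : ∀ g, ∃ k, k ≠ g ∧ k ≠ inv g) :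
    ∃ p > 0, ∃ ρ : ℝ, 0 < ρ ∧ ρ < 1 ∧ ∀ r : ℝ, ∃ C : ℝ, 0 ≤ C ∧ ∀ n x, R < N x →
      averagingIterate a T ({y | N y ≤ r}.indicator 1) (n + 1) x ≤ 1 - p + C * ρ ^ n := by
  obtain ⟨c, ρ, hρ0, hρ1, hc, hcc, hcρ⟩ := exists_contracted_letter_weights ha hsum hinv hne hthird
  -- p is at once a lower bound for the escape probability a g (1 - c g) and for every weight c g.
  have hev : ∀ᶠ t : ℝ in nhdsWithin 0 (Set.Ioi 0),
      ∀ g, (c g < 1 → t < a g * (1 - c g)) ∧ t < c g ∧ t < 1 :=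
    Filter.eventually_all.2 fun g => Filter.Eventually.filter_mono inf_le_left <| by
      refine Filter.Eventually.and ?_ ((eventually_lt_nhds (hc g)).and
        (eventually_lt_nhds one_pos))
      by_cases hg : c g < 1
      · filter_upwards [eventually_lt_nhds (mul_pos (ha g) (sub_pos.2 hg))] with t ht _ using ht
      · exact Filter.Eventually.of_forall fun t h => absurd h hg
  obtain ⟨p, hp, hp0⟩ := (hev.and self_mem_nhdsWithin).exists
  have hp0 : 0 < p := hp0
  refine ⟨p, hp0, ρ, hρ0, hρ1, fun r => ?_⟩
  -- A reduced path that ends in {N ≤ r} has length at most l, hence weight at least p ^ l.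
  set l : ℕ := ⌈r - R⌉₊
  have hf1 : ∀ x, ({y | N y ≤ r}.indicator 1 : X → ℝ) x ≤ 1 := fun x =>
    Set.indicator_le_self' (by simp) x
  have hpow : 0 < (p ^ l)⁻¹ := inv_pos.2 (pow_pos hp0 l)
  refine ⟨(p ^ l)⁻¹, hpow.le, fun n x hx => ?_⟩
  -- At most one bad set contains x. Some pair k, inv k avoids it, and c k * c (inv k) < 1 makes one
  -- of the two weights less than 1.
  obtain ⟨g, hgB, hg1⟩ : ∃ g, x ∉ B g ∧ c g < 1 := by
    have : ∀ k, c k < 1 ∨ c (inv k) < 1 := fun k => by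
      by_contra! hcon
      nlinarith [hcc k, hcon.1, hcon.2]
    by_cases hb : ∃ b, x ∈ B b
    · obtain ⟨b, hb⟩ := hb
      obtain ⟨k, hk1, hk2⟩ := hthird b
      rcases this k with h | h
      · exact ⟨k, fun h' => hk1 (H.disjoint x hx _ _ h' hb), h⟩
      · refine ⟨inv k, fun h' => hk2 ?_, h⟩
        rw [← H.disjoint x hx _ _ h' hb, hinv]
    · push Not at hb
      have hL : Nonempty L := by
        by_contra hL
        rw [not_nonempty_iff] at hL
        simp at hsum
      obtain ⟨k⟩ := hL
      rcases this k with h | h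
      exacts [⟨k, hb _, h⟩, ⟨_, hb _, h⟩]
  have h0 : ∀ w y, ReducedPath inv T g x w y →
      ({y | N y ≤ r}.indicator 1 : X → ℝ) y ≤ (w.map c).prod * (p ^ l)⁻¹ := fun w y hw => by
    have hprod : ∀ w : List L, p ^ w.length ≤ (w.map c).prod := fun w => by
      induction w with
      | nil => simp
      | cons k w ih =>
        rw [List.length_cons, List.map_cons, List.prod_cons, pow_succ']
        exact mul_le_mul (hp k).2.1.le ih (pow_pos hp0 _).le (hc k).le
    by_cases hy : N y ≤ r
    · rw [← div_eq_mul_inv]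
      refine (hf1 y).trans ((one_le_div (pow_pos hp0 l)).2 (le_trans ?_ (hprod w)))
      refine pow_le_pow_of_le_one hp0.le (hp g).2.2.le ?_
      have := (H.reducedPath_far hx hgB hw).2
      have h2 := Nat.le_ceil (r - R)
      have : (w.length : ℝ) ≤ l := by linarith
      exact_mod_cast this
    · rw [Set.indicator_of_notMem (show y ∉ {y | N y ≤ r} from hy)]
      exact mul_nonneg ((pow_pos hp0 _).le.trans (hprod w)) hpow.le
  have hgx := H.averagingIterate_le_of_reducedPath ha hsum hρ0 hρ1 hc hcρ hf1 hpow.le h0 n .single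
  rw [List.map_singleton, List.prod_singleton] at hgx
  have hsum' := Finset.add_sum_erase Finset.univ a (Finset.mem_univ g)
  have ha1 : a g ≤ 1 := hsum ▸ Finset.single_le_sum (fun h _ => (ha h).le) (Finset.mem_univ g)
  have hE : 0 ≤ (p ^ l)⁻¹ * ρ ^ n := mul_nonneg hpow.le (pow_pos hρ0 n).le
  calc averagingIterate a T ({y | N y ≤ r}.indicator 1) (n + 1) x
      = a g * averagingIterate a T ({y | N y ≤ r}.indicator 1) n (T g x) +
        ∑ h ∈ Finset.univ.erase g,
          a h * averagingIterate a T ({y | N y ≤ r}.indicator 1) n (T h x) :=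
        (Finset.add_sum_erase _ _ (Finset.mem_univ _)).symm
    _ ≤ a g * (c g * (1 + (p ^ l)⁻¹ * ρ ^ n)) + ∑ h ∈ Finset.univ.erase g, a h :=
        add_le_add (mul_le_mul_of_nonneg_left hgx (ha g).le) (Finset.sum_le_sum fun h _ =>
          mul_le_of_le_one_right (ha h).le (averagingIterate_le_one ha hsum T hf1 n _))
    _ ≤ 1 - p + (p ^ l)⁻¹ * ρ ^ n := by
        have h1 := (hp g).1 hg1
        have h2 : a g * c g * ((p ^ l)⁻¹ * ρ ^ n) ≤ 1 * ((p ^ l)⁻¹ * ρ ^ n) :=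
          mul_le_mul_of_nonneg_right (mul_le_one₀ ha1 (hc g).le hg1.le) hE
        linarith

/-- The escape probability p does not depend on r, so one may let n → ∞ for fixed r and then r → ∞.
-/
lemma measure_far_eq_zero [MeasurableSpace X] (H : PingPongAtInfinity inv T N B R) {a : L → ℝ}
    (ha : ∀ h, 0 < a h) (hsum : ∑ h, a h = 1) (hinv : Function.Involutive inv)
    (hne : ∀ g, inv g ≠ g) (hthird : ∀ g, ∃ k, k ≠ g ∧ k ≠ inv g)
    (hN : Measurable N) (hT : ∀ h, Measurable (T h)) {μ : Measure X} [IsProbabilityMeasure μ]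
    (hμ : ∑ h, ENNReal.ofReal (a h) • μ.map (T h) = μ) : μ {x | R < N x} = 0 := by
  have hint : ∀ f : X → ℝ, Measurable f → (∀ x, 0 ≤ f x) → (∀ x, f x ≤ 1) → Integrable f μ :=
    fun f hf h0 h1 => Integrable.of_bound hf.aestronglyMeasurable 1 <| ae_of_all _ fun x => by
      rw [Real.norm_of_nonneg (h0 x)]
      exact h1 x
  obtain ⟨p, hp0, ρ, hρ0, hρ1, hescape⟩ := H.exists_escape_probability ha hsum hinv hne hthird
  have hfar : MeasurableSet {x | R < N x} := measurableSet_lt measurable_const hN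
  have hball : ∀ r, MeasurableSet {x | N x ≤ r} := fun r => measurableSet_le hN measurable_const
  have hbound : ∀ r, μ.real {x | N x ≤ r} ≤ 1 - p * μ.real {x | R < N x} := fun r => by
    obtain ⟨C, hC, hCle⟩ := hescape r
    set f : X → ℝ := {y | N y ≤ r}.indicator 1 with hf
    have hf0 : ∀ x, 0 ≤ f x := fun x => Set.indicator_nonneg (by simp) x
    have hf1 : ∀ x, f x ≤ 1 := fun x => Set.indicator_le_self' (by simp) x
    have hfm : Measurable f := measurable_one.indicator (hball r)
    have hm := fun n => measurable_averagingIterate a hT hfm n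
    have h0 := fun n x => averagingIterate_nonneg ha T hf0 n x
    have h1 := fun n x => averagingIterate_le_one ha hsum T hf1 n x
    have hinvariant : ∀ n, ∫ x, averagingIterate a T f n x ∂μ = μ.real {x | N x ≤ r} := fun n => by
      induction n with
      | zero => exact integral_indicator_one (hball r)
      | succ n ih =>
        rw [← ih]
        conv_rhs => rw [← hμ]
        rw [integral_finsetSum_measure fun h _ => ?_]
        · refine (integral_finsetSum _ fun h _ => (hint _ ((hm n).comp (hT h))
            (fun _ => h0 n _) (fun _ => h1 n _)).const_mul (a h)).trans ?_
          refine Finset.sum_congr rfl fun h _ => ?_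
          rw [integral_smul_measure, integral_map (hT h).aemeasurable
            (hm n).aestronglyMeasurable, ENNReal.toReal_ofReal (ha h).le, smul_eq_mul,
            integral_const_mul]
          rfl
        · refine Integrable.smul_measure ?_ ENNReal.ofReal_ne_top
          rw [integrable_map_measure (hm n).aestronglyMeasurable (hT h).aemeasurable]
          exact hint _ ((hm n).comp (hT h)) (fun _ => h0 n _) (fun _ => h1 n _)
    have hle : ∀ n : ℕ, μ.real {x | N x ≤ r} ≤ 1 - p * μ.real {x | R < N x} + C * ρ ^ n :=
      fun n => by
      rw [← hinvariant (n + 1)]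
      have hgi : Integrable ({x | R < N x}.indicator fun _ => p) μ :=
        (integrable_const p).indicator hfar
      have hE : 0 ≤ C * ρ ^ n := mul_nonneg hC (pow_pos hρ0 n).le
      calc ∫ x, averagingIterate a T f (n + 1) x ∂μ
          ≤ ∫ x, ((1 + C * ρ ^ n) - {x | R < N x}.indicator (fun _ => p) x) ∂μ := by
            refine integral_mono (hint _ (hm _) (h0 _) (h1 _)) ((integrable_const _).sub hgi)
              fun x => ?_
            by_cases hx : R < N x
            · have := hCle n x hx
              simp only [Set.indicator_of_mem (show x ∈ {x | R < N x} from hx)]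
              linarith
            · have := h1 (n + 1) x
              simp only [Set.indicator_of_notMem (show x ∉ {x | R < N x} from hx)]
              linarith
        _ = 1 - p * μ.real {x | R < N x} + C * ρ ^ n := by
            rw [integral_sub (integrable_const _) hgi, integral_indicator_const _ hfar]
            simp
            ring
    have hlim : Filter.Tendsto
        (fun n : ℕ => 1 - p * μ.real {x | R < N x} + C * ρ ^ n) Filter.atTop
        (nhds (1 - p * μ.real {x | R < N x} + C * 0)) :=
      ((tendsto_pow_atTop_nhds_zero_of_lt_one hρ0.le hρ1).const_mul C).const_add _
    simpa using ge_of_tendsto' hlim hle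
  have hlim : Filter.Tendsto (fun n : ℕ => μ.real {x | N x ≤ n}) Filter.atTop (nhds 1) := by
    have hmono : Monotone fun n : ℕ => {x | N x ≤ n} := fun i j hij x hx =>
      le_trans (show N x ≤ i from hx) (Nat.cast_le.2 hij)
    have hU : ⋃ n : ℕ, {x | N x ≤ n} = Set.univ :=
      Set.eq_univ_of_forall fun x => Set.mem_iUnion.2 (exists_nat_ge (N x))
    have := tendsto_measure_iUnion_atTop (μ := μ) hmono
    rw [hU, measure_univ] at this
    exact (ENNReal.tendsto_toReal ENNReal.one_ne_top).comp this
  have h1 := le_of_tendsto' hlim fun n : ℕ => hbound n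
  have h2 : μ.real {x | R < N x} = 0 := by
    have := measureReal_nonneg (μ := μ) (s := {x | R < N x})
    nlinarith
  exact (measureReal_eq_zero_iff).1 h2

end PingPongAtInfinity

end


/-! ### Hénon maps near infinity -/

/-- P(y) = y Q(y) + P(0) with Q nonconstant, so |Q| tends to infinity. -/
lemma Polynomial.exists_mul_norm_le_norm_eval {P : Polynomial ℂ} (hP : 2 ≤ P.natDegree) (K : ℝ) :
    ∃ M : ℝ, ∀ y : ℂ, M ≤ ‖y‖ → K * ‖y‖ ≤ ‖P.eval y‖ := by
  have hdeg : 0 < P.divX.degree := by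
    rw [← Polynomial.natDegree_pos_iff_degree_pos, Polynomial.natDegree_divX_eq_natDegree_tsub_one]
    omega
  have h1 := P.divX.tendsto_norm_atTop hdeg (l := Filter.comap norm Filter.atTop)
    (z := fun y : ℂ => y) Filter.tendsto_comap
  have h2 := h1.eventually_ge_atTop (K + 1)
  rw [Filter.eventually_comap, Filter.eventually_atTop] at h2
  obtain ⟨M, hM⟩ := h2
  refine ⟨max M ‖P.coeff 0‖, fun y hy => ?_⟩
  have h3 := hM ‖y‖ ((le_max_left _ _).trans hy) y rfl
  have h4 : P.eval y = P.divX.eval y * y + P.coeff 0 := by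
    conv_lhs => rw [← P.divX_mul_X_add]
    simp
  have h5 := norm_sub_le_norm_add (P.divX.eval y * y) (P.coeff 0)
  rw [h4]
  rw [norm_mul] at h5
  have h6 := mul_le_mul_of_nonneg_right h3 (norm_nonneg y)
  linarith [(le_max_right M ‖P.coeff 0‖).trans hy]

/-- The cone around the first coordinate axis of `ℂ²`, or the second one if `i` is true. -/
def axisCone (ε : ℝ) (i : Bool) : Set (ℂ × ℂ) :=
  if i then {z | ‖z.1‖ ≤ ε * ‖z.2‖} else {z | ‖z.2‖ ≤ ε * ‖z.1‖}

/-- The Hénon map, or its inverse if `i` is true. -/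
noncomputable def henonPower (P : Polynomial ℂ) (δ : ℂ) (hδ : δ ≠ 0) (i : Bool) :
    (ℂ × ℂ) ≃ₜ (ℂ × ℂ) :=
  if i then (henonMap P δ hδ)⁻¹ else henonMap P δ hδ

lemma henonMap_apply (P : Polynomial ℂ) (δ : ℂ) (hδ : δ ≠ 0) (z : ℂ × ℂ) :
    henonMap P δ hδ z = (z.2, P.eval z.2 - δ * z.1) := rfl

lemma henonMap_inv_apply (P : Polynomial ℂ) (δ : ℂ) (hδ : δ ≠ 0) (z : ℂ × ℂ) :
    (henonMap P δ hδ)⁻¹ z = ((P.eval z.1 - z.2) / δ, z.1) := rfl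

lemma henonPower_far {P : Polynomial ℂ} (hP : 2 ≤ P.natDegree) {δ : ℂ} (hδ : δ ≠ 0) {ε : ℝ}
    (hε0 : 0 < ε) (hε1 : ε ≤ 1) (Λ : ℝ) :
    ∃ R : ℝ, ∀ z, R < ‖z‖ → ∀ i, z ∉ axisCone ε i →
      henonPower P δ hδ i z ∈ axisCone ε (!i) ∧ Λ * ‖z‖ ≤ ‖henonPower P δ hδ i z‖ := by
  have hδ' : 0 < ‖δ‖ := norm_pos_iff.2 hδ
  -- The first entry puts the image into the cone, the second yields the expansion by Λ.
  set K : ℝ := max (1 / ε) (|Λ| / ε) with hK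
  have hK1 : 1 ≤ ε * K := by
    have := mul_le_mul_of_nonneg_left (le_max_left (1 / ε) (|Λ| / ε)) hε0.le
    rwa [mul_one_div_cancel hε0.ne'] at this
  have hK2 : Λ ≤ K * ε := by
    have := mul_le_mul_of_nonneg_right (le_max_right (1 / ε) (|Λ| / ε)) hε0.le
    rw [div_mul_cancel₀ _ hε0.ne'] at this
    exact (le_abs_self Λ).trans this
  have hK0 : 0 ≤ K := by positivity
  -- The two constants absorb the linear term of the map and of its inverse, respectively.
  obtain ⟨M, hM⟩ := P.exists_mul_norm_le_norm_eval hP (max (K + ‖δ‖ / ε) (K * ‖δ‖ + 1 / ε))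
  -- Here t is the coordinate fed to P, and s the other one.
  have core : ∀ t s : ℂ, M / ε < max ‖t‖ ‖s‖ → ¬ ‖t‖ ≤ ε * ‖s‖ →
      Λ * max ‖t‖ ‖s‖ ≤ K * ‖t‖ ∧ ‖t‖ ≤ ε * (K * ‖t‖) ∧
        (K + ‖δ‖ / ε) * ‖t‖ ≤ ‖P.eval t‖ ∧ (K * ‖δ‖ + 1 / ε) * ‖t‖ ≤ ‖P.eval t‖ ∧
        ‖s‖ ≤ ‖t‖ / ε := by
    intro t s hfar hcone
    push Not at hcone
    have hmax : ε * max ‖t‖ ‖s‖ ≤ ‖t‖ := by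
      rw [mul_max_of_nonneg _ _ hε0.le]
      exact max_le (mul_le_of_le_one_left (norm_nonneg _) hε1) hcone.le
    have hMt : M ≤ ‖t‖ := by
      rw [div_lt_iff₀ hε0] at hfar
      linarith
    have := hM t hMt
    refine ⟨?_, ?_, ?_, ?_, ?_⟩
    · calc Λ * max ‖t‖ ‖s‖ ≤ K * ε * max ‖t‖ ‖s‖ := mul_le_mul_of_nonneg_right hK2 (by positivity)
        _ = K * (ε * max ‖t‖ ‖s‖) := mul_assoc _ _ _
        _ ≤ _ := mul_le_mul_of_nonneg_left hmax hK0
    · rw [← mul_assoc]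
      exact le_mul_of_one_le_left (norm_nonneg _) hK1
    · exact (mul_le_mul_of_nonneg_right (le_max_left _ _) (norm_nonneg _)).trans this
    · exact (mul_le_mul_of_nonneg_right (le_max_right _ _) (norm_nonneg _)).trans this
    · rw [le_div_iff₀ hε0]
      linarith
  refine ⟨M / ε, fun z hz i hi => ?_⟩
  cases i
  · obtain ⟨h1, h2, h3, -, h5⟩ := core z.2 z.1 (by rwa [max_comm]) hi
    have h6 : K * ‖z.2‖ ≤ ‖P.eval z.2 - δ * z.1‖ := by
      have h7 := norm_sub_norm_le (P.eval z.2) (δ * z.1)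
      rw [norm_mul] at h7
      have h8 := mul_le_mul_of_nonneg_left h5 hδ'.le
      have h9 : ‖δ‖ / ε * ‖z.2‖ = ‖δ‖ * (‖z.2‖ / ε) := by ring
      linarith
    constructor
    · exact h2.trans (mul_le_mul_of_nonneg_left h6 hε0.le)
    · rw [max_comm] at h1
      exact (h1.trans h6).trans (le_max_right ‖z.2‖ _)
  · obtain ⟨h1, h2, -, h4, h5⟩ := core z.1 z.2 hz hi
    have h6 : K * ‖z.1‖ ≤ ‖(P.eval z.1 - z.2) / δ‖ := by
      rw [norm_div, le_div_iff₀ hδ']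
      have h7 := norm_sub_norm_le (P.eval z.1) z.2
      have h9 : 1 / ε * ‖z.1‖ = ‖z.1‖ / ε := by ring
      linarith
    constructor
    · exact h2.trans (mul_le_mul_of_nonneg_left h6 hε0.le)
    · exact (h1.trans h6).trans (le_max_left _ ‖z.1‖)

/-! ### Rotated cones and the ping-pong of the four letters -/

/-- The rotation `R_θ` if `r` is true, and the identity otherwise. -/
noncomputable def rotationPower (θ : ℝ) (r : Bool) : (ℂ × ℂ) ≃ₜ (ℂ × ℂ) :=
  if r then rotationMap θ else 1

lemma norm_rotation_le {a b : ℝ} (ha : |a| ≤ 1) (hb : |b| ≤ 1) {z : ℂ × ℂ} :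
    ‖(a : ℂ) * z.1‖ + ‖(b : ℂ) * z.2‖ ≤ 2 * ‖z‖ := by
  rw [norm_mul, norm_mul, Complex.norm_real, Complex.norm_real, Real.norm_eq_abs, Real.norm_eq_abs]
  have h1 := mul_le_mul ha (norm_fst_le z) (norm_nonneg _) zero_le_one
  have h2 := mul_le_mul hb (norm_snd_le z) (norm_nonneg _) zero_le_one
  linarith

lemma norm_rotationPower_le (θ : ℝ) (r : Bool) (z : ℂ × ℂ) :
    ‖rotationPower θ r z‖ ≤ 2 * ‖z‖ := by
  cases r
  · exact le_mul_of_one_le_left (norm_nonneg z) one_le_two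
  · have hc := Real.abs_cos_le_one θ
    have hs := Real.abs_sin_le_one θ
    exact max_le ((norm_sub_le _ _).trans (norm_rotation_le hc hs))
      ((norm_add_le _ _).trans (norm_rotation_le hs hc))

lemma norm_rotationPower_inv_le (θ : ℝ) (r : Bool) (z : ℂ × ℂ) :
    ‖(rotationPower θ r)⁻¹ z‖ ≤ 2 * ‖z‖ := by
  cases r
  · exact le_mul_of_one_le_left (norm_nonneg z) one_le_two
  · have hc := Real.abs_cos_le_one θ
    have hs := Real.abs_sin_le_one θ
    refine max_le ((norm_add_le _ _).trans (norm_rotation_le hc hs))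
      ((norm_add_le _ _).trans ?_)
    have := norm_rotation_le (a := -Real.sin θ) (b := Real.cos θ) (by rwa [abs_neg]) hc (z := z)
    push_cast at this ⊢
    exact this

/-- The letters of the random walk on `⟨h₁, h₂⟩`: the pair `(r, i)` stands for `h₁` or `h₂` (if `r`
is true), inverted if `i` is true. -/
noncomputable def henonLetter (P : Polynomial ℂ) (δ : ℂ) (hδ : δ ≠ 0) (θ : ℝ) (l : Bool × Bool) :
    (ℂ × ℂ) ≃ₜ (ℂ × ℂ) :=
  (rotationPower θ l.1)⁻¹ * henonPower P δ hδ l.2 * rotationPower θ l.1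

lemma henonLetter_apply (P : Polynomial ℂ) (δ : ℂ) (hδ : δ ≠ 0) (θ : ℝ) (l : Bool × Bool)
    (z : ℂ × ℂ) : henonLetter P δ hδ θ l z =
      (rotationPower θ l.1)⁻¹ (henonPower P δ hδ l.2 (rotationPower θ l.1 z)) := rfl

lemma henonLetter_inv (P : Polynomial ℂ) (δ : ℂ) (hδ : δ ≠ 0) (θ : ℝ) (r i : Bool) :
    henonLetter P δ hδ θ (r, !i) = (henonLetter P δ hδ θ (r, i))⁻¹ := by
  cases i <;> simp [henonLetter, henonPower, mul_assoc]

lemma axisCone_zero_of_mem {ε : ℝ} (hε0 : 0 < ε) (hε1 : ε < 1) {z : ℂ × ℂ} {i : Bool}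
    (h1 : z ∈ axisCone ε i) (h2 : z ∈ axisCone ε (!i)) : z = 0 := by
  have key : ∀ s t : ℂ, ‖s‖ ≤ ε * ‖t‖ → ‖t‖ ≤ ε * ‖s‖ → s = 0 ∧ t = 0 := fun s t h1 h2 => by
    have h3 := norm_nonneg s
    have h4 := norm_nonneg t
    have h5 : ‖s‖ = 0 := by nlinarith
    have h6 : ‖t‖ = 0 := by nlinarith
    exact ⟨norm_eq_zero.1 h5, norm_eq_zero.1 h6⟩
  cases i
  · exact Prod.ext (key _ _ h1 h2).2 (key _ _ h1 h2).1
  · exact Prod.ext (key _ _ h1 h2).1 (key _ _ h1 h2).2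

/-- If `(t, s)` lies in a thin cone around the first axis, its image under a rotation with no zero
entry does not lie in thin cones around the axes. -/
lemma eq_zero_of_rotation_small {ε a b : ℝ} (hε0 : 0 < ε) (hε1 : ε ≤ 1) (ha : |a| ≤ 1)
    (hb : |b| ≤ 1) (hεb : 4 * ε ≤ |b|) {s t u v : ℂ} (hst : ‖s‖ ≤ ε * ‖t‖)
    (hu : ‖(b : ℂ) * t‖ ≤ ‖u‖ + ‖(a : ℂ) * s‖) (hv : ‖v‖ ≤ ‖(a : ℂ) * t‖ + ‖(b : ℂ) * s‖)
    (huv : ‖u‖ ≤ ε * ‖v‖) : t = 0 := by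
  rw [norm_mul, norm_mul, Complex.norm_real, Complex.norm_real, Real.norm_eq_abs,
    Real.norm_eq_abs] at hu hv
  have ht := norm_nonneg t
  have hs := norm_nonneg s
  have h1 : |a| * ‖s‖ ≤ ε * ‖t‖ := (mul_le_of_le_one_left hs ha).trans hst
  have h2 : |b| * ‖s‖ ≤ ‖t‖ := ((mul_le_of_le_one_left hs hb).trans hst).trans
    (mul_le_of_le_one_left ht hε1)
  have h3 : |a| * ‖t‖ ≤ ‖t‖ := mul_le_of_le_one_left ht ha
  have h4 : 4 * ε * ‖t‖ ≤ |b| * ‖t‖ := mul_le_mul_of_nonneg_right hεb ht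
  have h5 : ε * ‖v‖ ≤ ε * (2 * ‖t‖) := mul_le_mul_of_nonneg_left (by linarith) hε0.le
  have h6 : ε * ‖t‖ ≤ 0 := by linarith
  exact norm_eq_zero.1 (le_antisymm (nonpos_of_mul_nonpos_right h6 hε0) ht)

/-- A rotation with no zero entry moves each axis off both axes, quantitatively by 4ε. The four
cases differ only in which of sin θ, cos θ multiplies the large coordinate. -/
lemma axisCone_rotation_disjoint {ε θ : ℝ} (hε0 : 0 < ε) (hε1 : ε < 1)
    (hs : 4 * ε ≤ |Real.sin θ|) (hc : 4 * ε ≤ |Real.cos θ|) {z : ℂ × ℂ} {i j : Bool}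
    (h1 : z ∈ axisCone ε i) (h2 : rotationMap θ z ∈ axisCone ε j) : z = 0 := by
  have hc1 := Real.abs_cos_le_one θ
  have hs1 := Real.abs_sin_le_one θ
  have hle : ∀ p q : ℂ, ‖p‖ ≤ ‖p - q‖ + ‖q‖ ∧ ‖q‖ ≤ ‖p - q‖ + ‖p‖ ∧ ‖p‖ ≤ ‖p + q‖ + ‖q‖ ∧
      ‖q‖ ≤ ‖p + q‖ + ‖p‖ := fun p q => by
    refine ⟨?_, ?_, ?_, ?_⟩
    · simpa using norm_add_le (p - q) q
    · simpa [norm_sub_rev] using norm_add_le (q - p) p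
    · simpa using norm_sub_le (p + q) q
    · simpa using norm_sub_le (p + q) p
  have hu := hle ((Real.cos θ : ℂ) * z.1) ((Real.sin θ : ℂ) * z.2)
  have hv := hle ((Real.sin θ : ℂ) * z.1) ((Real.cos θ : ℂ) * z.2)
  have nu := norm_sub_le ((Real.cos θ : ℂ) * z.1) ((Real.sin θ : ℂ) * z.2)
  have nv := norm_add_le ((Real.sin θ : ℂ) * z.1) ((Real.cos θ : ℂ) * z.2)
  have fin : ∀ {s t : ℂ}, ‖s‖ ≤ ε * ‖t‖ → t = 0 → s = 0 := fun h ht => by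
    simpa [ht] using h
  cases i
  · have ht : z.1 = 0 := by
      cases j
      · exact eq_zero_of_rotation_small hε0 hε1.le hc1 hs1 hs h1 hv.2.2.1 nu h2
      · exact eq_zero_of_rotation_small hε0 hε1.le hs1 hc1 hc h1 hu.1 nv h2
    exact Prod.ext ht (fin h1 ht)
  · have ht : z.2 = 0 := by
      cases j
      · exact eq_zero_of_rotation_small hε0 hε1.le hs1 hc1 hc h1 hv.2.2.2
          (nu.trans_eq (add_comm _ _)) h2
      · exact eq_zero_of_rotation_small hε0 hε1.le hc1 hs1 hs h1 hu.2.1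
          (nv.trans_eq (add_comm _ _)) h2
    exact Prod.ext (fin h1 ht) ht

lemma exists_henonLetter_pingPong {P : Polynomial ℂ} (hP : 2 ≤ P.natDegree) {δ : ℂ} (hδ : δ ≠ 0)
    {θ : ℝ} (hs : Real.sin θ ≠ 0) (hc : Real.cos θ ≠ 0) :
    ∃ (B : Bool × Bool → Set (ℂ × ℂ)) (R : ℝ), PingPongAtInfinity (fun l => (l.1, !l.2))
      (fun l z => henonLetter P δ hδ θ l z) norm B R := by
  set ε : ℝ := min |Real.sin θ| |Real.cos θ| / 4 with hε
  have hmin : 0 < min |Real.sin θ| |Real.cos θ| := lt_min (abs_pos.2 hs) (abs_pos.2 hc)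
  have hε0 : 0 < ε := by positivity
  have hεs : 4 * ε ≤ |Real.sin θ| := by linarith [min_le_left |Real.sin θ| |Real.cos θ|]
  have hεc : 4 * ε ≤ |Real.cos θ| := by linarith [min_le_right |Real.sin θ| |Real.cos θ|]
  have hε1 : ε < 1 := by linarith [Real.abs_sin_le_one θ]
  -- In the sup norm `rotationPower` and its inverse each cost a factor 2, so expansion by 8 leaves
  -- a doubling, which exceeds adding 1 once ‖z‖ > 1.
  obtain ⟨R, hR⟩ := henonPower_far hP hδ hε0 hε1.le 8
  have hcancel : ∀ r z, (rotationPower θ r)⁻¹ (rotationPower θ r z) = z := fun r z =>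
    (rotationPower θ r).symm_apply_apply z
  have hcancel' : ∀ r z, rotationPower θ r ((rotationPower θ r)⁻¹ z) = z := fun r z =>
    (rotationPower θ r).apply_symm_apply z
  have hlower : ∀ r z, ‖z‖ ≤ 2 * ‖rotationPower θ r z‖ := fun r z => by
    simpa only [hcancel] using norm_rotationPower_inv_le θ r (rotationPower θ r z)
  have hlower' : ∀ r z, ‖z‖ ≤ 2 * ‖(rotationPower θ r)⁻¹ z‖ := fun r z => by
    simpa only [hcancel'] using norm_rotationPower_le θ r ((rotationPower θ r)⁻¹ z)
  refine ⟨fun l => {z | rotationPower θ l.1 z ∈ axisCone ε l.2}, max 1 (2 * R),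
    ⟨?_, ?_, ?_, ?_⟩⟩
  · rintro ⟨r, i⟩ z
    change henonLetter P δ hδ θ (r, !i) (henonLetter P δ hδ θ (r, i) z) = z
    rw [henonLetter_inv]
    exact (henonLetter P δ hδ θ (r, i)).symm_apply_apply z
  · rintro z hz ⟨r, i⟩ ⟨r', i'⟩ h h'
    have hz0 : z ≠ 0 := by
      rintro rfl
      rw [norm_zero] at hz
      linarith [le_max_left 1 (2 * R)]
    have hrot : ∀ i j, z ∈ axisCone ε i → rotationMap θ z ∉ axisCone ε j := fun i j h1 h2 =>
      hz0 (axisCone_rotation_disjoint hε0 hε1 hεs hεc h1 h2)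
    have hrr : r = r' := by
      cases r <;> cases r'
      · rfl
      · exact absurd h' (hrot _ _ h)
      · exact absurd h (hrot _ _ h')
      · rfl
    subst hrr
    refine Prod.ext rfl (by_contra fun hii => ?_)
    have hi : i' = !i := by
      have : i ≠ i' := hii
      revert this
      cases i <;> cases i' <;> simp
    subst hi
    have h0 : rotationPower θ r z = 0 := axisCone_zero_of_mem hε0 hε1 h h'
    have := hlower r z
    rw [h0, norm_zero, mul_zero] at this
    exact hz0 (norm_le_zero_iff.1 this)
  · rintro z hz ⟨r, i⟩ h
    have hfar : R < ‖rotationPower θ r z‖ := by linarith [hlower r z, le_max_right 1 (2 * R)]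
    change rotationPower θ r (henonLetter P δ hδ θ (r, i) z) ∈ axisCone ε (!i)
    rw [henonLetter_apply, hcancel']
    exact (hR _ hfar i h).1
  · rintro z hz ⟨r, i⟩ h
    have hfar : R < ‖rotationPower θ r z‖ := by linarith [hlower r z, le_max_right 1 (2 * R)]
    change ‖z‖ + 1 ≤ ‖henonLetter P δ hδ θ (r, i) z‖
    rw [henonLetter_apply]
    dsimp only
    have h1 := (hR _ hfar i h).2
    have h2 := hlower r z
    have h3 := hlower' r (henonPower P δ hδ i (rotationPower θ r z))
    have h4 := (le_max_left 1 (2 * R)).trans_lt hz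
    linarith

/-! ### From the stationary measure to the four-letter walk -/

lemma sin_cos_ne_zero_of_mem {θ : ℝ}
    (hθ : θ ∈ Set.Ioo 0 (2 * Real.pi) \ {Real.pi / 2, 3 * Real.pi / 2, Real.pi}) :
    Real.sin θ ≠ 0 ∧ Real.cos θ ≠ 0 := by
  obtain ⟨⟨h0, h2⟩, hne⟩ := hθ
  simp only [Set.mem_insert_iff, Set.mem_singleton_iff, not_or] at hne
  -- The zeros of sin 2θ in (0, 2π) are exactly the three excluded angles.
  have key : Real.sin (2 * θ) ≠ 0 := by
    intro h
    obtain ⟨n, hn⟩ := Real.sin_eq_zero_iff.1 h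
    have hpi := Real.pi_pos
    have h3 : (0 : ℝ) < n := by
      by_contra! hcon
      nlinarith
    have h4 : (n : ℝ) < 4 := by
      by_contra! hcon
      nlinarith
    have h5 : 0 < n := by exact_mod_cast h3
    have h6 : n < 4 := by exact_mod_cast h4
    obtain ⟨ha, hb, hc⟩ := hne
    interval_cases n
    · exact ha (by push_cast at hn; linarith)
    · exact hc (by push_cast at hn; linarith)
    · exact hb (by push_cast at hn; linarith)
  rw [Real.sin_two_mul] at key
  exact ⟨fun h => key (by simp [h]), fun h => key (by simp [h])⟩

/-- The step probabilities of the random walk, indexed by the letters of `henonLetter`. -/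
def letterWeight (a₁ a₂ a₃ a₄ : ℝ) : Bool × Bool → ℝ
  | (false, false) => a₁
  | (true, false) => a₂
  | (false, true) => a₃
  | (true, true) => a₄

lemma sum_map_henonLetter_eq {P : Polynomial ℂ} {δ : ℂ} {hδ : δ ≠ 0} {θ a₁ a₂ a₃ a₄ : ℝ}
    {μ : Measure (ℂ × ℂ)}
    (hμ : IsStationaryMeasure (henonGroup.stepMeasure P δ hδ θ a₁ a₂ a₃ a₄) μ) :
    ∑ l, ENNReal.ofReal (letterWeight a₁ a₂ a₃ a₄ l) •
      μ.map (fun z => henonLetter P δ hδ θ l z) = μ := by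
  have e₁ : henonLetter P δ hδ θ (false, false) = henonMap P δ hδ := by
    simp [henonLetter, henonPower, rotationPower]
  have e₂ : henonLetter P δ hδ θ (true, false) = rotatedHenonMap P δ hδ θ := rfl
  have e₃ := henonLetter_inv P δ hδ θ false false
  have e₄ := henonLetter_inv P δ hδ θ true false
  rw [e₁] at e₃
  rw [e₂] at e₄
  ext A hA
  rw [← hμ A hA]
  simp only [henonGroup.stepMeasure, lintegral_add_measure, lintegral_smul_measure,
    lintegral_dirac, Fintype.sum_prod_type, Fintype.sum_bool, letterWeight,
    Measure.add_apply, Measure.smul_apply, smul_eq_mul]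
  have e₃ : henonLetter P δ hδ θ (false, true) = (henonMap P δ hδ)⁻¹ := e₃
  have e₄ : henonLetter P δ hδ θ (true, true) = (rotatedHenonMap P δ hδ θ)⁻¹ := e₄
  rw [e₁, e₂, e₃, e₄]
  have g₁ : (fun z => henonGroup.gen₁ P δ hδ θ • z) = henonMap P δ hδ := rfl
  have g₂ : (fun z => henonGroup.gen₂ P δ hδ θ • z) = rotatedHenonMap P δ hδ θ := rfl
  have g₃ : (fun z => (henonGroup.gen₁ P δ hδ θ)⁻¹ • z) =
    ((henonMap P δ hδ)⁻¹ : (ℂ × ℂ) ≃ₜ (ℂ × ℂ)) := rfl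
  have g₄ : (fun z => (henonGroup.gen₂ P δ hδ θ)⁻¹ • z) =
    ((rotatedHenonMap P δ hδ θ)⁻¹ : (ℂ × ℂ) ≃ₜ (ℂ × ℂ)) := rfl
  rw [g₁, g₂, g₃, g₄]
  ring

theorem theoremB (P : Polynomial ℂ) (hP : 2 ≤ P.natDegree) (δ : ℂ) (hδ : δ ≠ 0)
    (θ : ℝ) (hθ : θ ∈ Set.Ioo 0 (2 * Real.pi) \ {Real.pi / 2, 3 * Real.pi / 2, Real.pi})
    (a₁ a₂ a₃ a₄ : ℝ) (ha₁ : 0 < a₁) (ha₂ : 0 < a₂) (ha₃ : 0 < a₃) (ha₄ : 0 < a₄)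
    (ha : a₁ + a₂ + a₃ + a₄ = 1)
    (μ : MeasureTheory.Measure (ℂ × ℂ)) [MeasureTheory.IsProbabilityMeasure μ]
    (hμ : IsStationaryMeasure (henonGroup.stepMeasure P δ hδ θ a₁ a₂ a₃ a₄) μ) :
    IsCompact μ.support := by
  obtain ⟨hs, hc⟩ := sin_cos_ne_zero_of_mem hθ
  obtain ⟨B, R, H⟩ := exists_henonLetter_pingPong hP hδ hs hc
  have hpos : ∀ l, 0 < letterWeight a₁ a₂ a₃ a₄ l := by
    rintro ⟨_ | _, _ | _⟩ <;> assumption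
  have hsum : ∑ l, letterWeight a₁ a₂ a₃ a₄ l = 1 := by
    simp only [Fintype.sum_prod_type, Fintype.sum_bool, letterWeight]
    linarith
  have hfar := H.measure_far_eq_zero hpos hsum (fun l => by simp) (by decide) (by decide)
    measurable_norm (fun l => (henonLetter P δ hδ θ l).continuous.measurable)
    (sum_map_henonLetter_eq hμ)
  refine (isCompact_closedBall (0 : ℂ × ℂ) R).of_isClosed_subset Measure.isClosed_support
    (Measure.support_subset_of_isClosed Metric.isClosed_closedBall ?_)
  rw [mem_ae_iff]
  convert hfar using 2
  ext z
  simp
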